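/- Let $(\Omega,\mathcal F,\mathbb P)$ be a nonatomic probability space, let $p\in[1,\infty)$ and let $q=(1-1/p)^{-1}\in(1,\infty]$ be its conjugate exponent. A random variable is called nonconstant if it is not almost surely equal to a constant. Let $g:[0,\infty)\to\mathbb R$ be a convex, non-constant, increasing (in the non-strict sense) and $1$-Lipschitz function with $g(0)=0$. Let $a=\lim_{x\to\infty}g'(x)$, where $g'$ is the left derivative of $g$, and let $g^*(y)=\sup_{x\ge 0}\{xy-g(x)\}\in(-\infty,\infty]$ for $y\in\mathbb R$. Let $D:L^p\to[0,\infty)$ be a range normalized law-invariant deviation measure, that is, for all $X,Y\in L^p$: $D(X+c)=D(X)$ for $c\in\mathbb R$; $D(X)>0$ if $X$ is nonconstant; $D(\lambda X)=\lambda D(X)$ for $\lambda\ge 0$; $D(X+Y)\le D(X)+D(Y)$; $D(X)=D(Y)$ if $X$ and $Y$ have the same distribution; and $$\sup\left\{\frac{D(X)}{\operatorname{ess\,sup}X-\mathbb E[X]} : X\in L^p \text{ nonconstant}\right\}=1,$$ where the quotient is $0$ if $\operatorname{ess\,sup}X=\infty$. Put $\mathrm{MD}^D_g(X)=g(D(X))+\mathbb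 E[X]$ for $X\in L^p$. Then there is a convex, $\sigma(L^q,L^p)$-compact set $\mathcal A\subseteq\{Z\in L^q: Z\ge 0,\ \mathbb E[Z]=1\}$ such that $$D(X)+\mathbb E[X]=\max_{Z\in\mathcal A}\mathbb E[XZ]\qquad\text{for all }X\in L^p, \tag{$*$}$$ and for every convex, $\sigma(L^q,L^p)$-compact set $\mathcal A\subseteq\{Z\in L^q: Z\ge 0,\ \mathbb E[Z]=1\}$ satisfying $(*)$ and every $X\in L^p$, $$\mathrm{MD}^D_g(X)=\max_{Z\in\mathcal A}\left\{a\,\mathbb E[XZ]-g^*\!\left(\frac{a}{\sup\{\lambda\in[1,\infty):\lambda(Z-1)+1\in\mathcal A\}}\right)\right\}+(1-a)\,\mathbb E[X],$$ where $a/\infty=0$, the expression in braces is $-\infty$ if the value of $g^*$ is $\infty$, and the maximum is attained. -/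

import Mathlib

open MeasureTheory ProbabilityTheory Set Filter Topology
open scoped ENNReal

noncomputable section

namespace MeanDeviation

/-- `μ` is nonatomic: every measurable set of positive measure contains a measurable subset of
strictly smaller positive measure. -/
def Nonatomic {Ω : Type*} [MeasurableSpace Ω] (μ : Measure Ω) : Prop :=
  ∀ A : Set Ω, MeasurableSet A → 0 < μ A →
    ∃ B : Set Ω, MeasurableSet B ∧ B ⊆ A ∧ 0 < μ B ∧ μ B < μ A

/-- `X` is a nonconstant random variable (up to almost sure equality). -/
def Nonconstant {Ω : Type*} [MeasurableSpace Ω] {μ : Measure Ω} [IsProbabilityMeasure μ]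
    {p : ℝ≥0∞} (X : Lp ℝ p μ) : Prop :=
  ∀ c : ℝ, X ≠ Lp.const p μ c

/-- Law-invariant deviation measures `D : L^p → [0, ∞)`. -/
structure IsDeviationMeasure {Ω : Type*} [MeasurableSpace Ω] {μ : Measure Ω}
    [IsProbabilityMeasure μ] {p : ℝ≥0∞} (D : Lp ℝ p μ → ℝ) : Prop where
  nonneg : ∀ X, 0 ≤ D X
  add_const : ∀ (X : Lp ℝ p μ) (c : ℝ), D (X + Lp.const p μ c) = D X
  pos : ∀ X : Lp ℝ p μ, Nonconstant X → 0 < D X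
  pos_homog : ∀ (X : Lp ℝ p μ) (l : ℝ), 0 ≤ l → D (l • X) = l * D X
  subadd : ∀ X Y : Lp ℝ p μ, D (X + Y) ≤ D X + D Y
  law_invariant : ∀ X Y : Lp ℝ p μ, IdentDistrib (X : Ω → ℝ) (Y : Ω → ℝ) μ μ → D X = D Y

/-- The essential supremum of a random variable, with values in `[-∞, ∞]`. -/
def essSupE {Ω : Type*} [MeasurableSpace Ω] {μ : Measure Ω} {p : ℝ≥0∞}
    (X : Lp ℝ p μ) : EReal :=
  essSup (fun ω => ((X ω : ℝ) : EReal)) μ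

/-- Range normalized deviation measures: the supremum over nonconstant `X` of
`D X / (ess-sup X - E[X])` equals `1` (the quotient is `0` when `ess-sup X = ∞`). -/
structure IsRangeNormalized {Ω : Type*} [MeasurableSpace Ω] {μ : Measure Ω}
    [IsProbabilityMeasure μ] {p : ℝ≥0∞} (D : Lp ℝ p μ → ℝ) : Prop
    extends IsDeviationMeasure D where
  sup_eq_one :
    (⨆ (X : Lp ℝ p μ) (_ : Nonconstant X),
      (D X : EReal) / (essSupE X - ((∫ ω, X ω ∂μ : ℝ) : EReal))) = 1

/-- Risk-weighting functions `g : [0, ∞) → ℝ`: nonconstant, increasing, `1`-Lipschitz, and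
`g 0 = 0`. Only the values of `g` on `[0, ∞)` are ever used. -/
structure IsRiskWeighting (g : ℝ → ℝ) : Prop where
  zero : g 0 = 0
  mono : MonotoneOn g (Ici 0)
  lipschitz : LipschitzOnWith 1 g (Ici 0)
  nonconst : ∃ x ∈ Ici (0 : ℝ), ∃ y ∈ Ici (0 : ℝ), g x ≠ g y

/-- The left derivative of `g` at `x`. -/
def leftDeriv (g : ℝ → ℝ) (x : ℝ) : ℝ := derivWithin g (Iio x) x

/-- The conjugate `g*(y) = sup_{x ≥ 0} {x y - g(x)}`, with values in `(-∞, ∞]`. -/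
def conjugate (g : ℝ → ℝ) (y : ℝ) : EReal :=
  ⨆ (x : ℝ) (_ : 0 ≤ x), ((x * y - g x : ℝ) : EReal)

/-- The monotonic mean-deviation measure `g ∘ D + E`. -/
def MD {Ω : Type*} [MeasurableSpace Ω] {μ : Measure Ω} {p : ℝ≥0∞}
    (D : Lp ℝ p μ → ℝ) (g : ℝ → ℝ) (X : Lp ℝ p μ) : ℝ :=
  g (D X) + ∫ ω, X ω ∂μ

theorem integrable_mul {Ω : Type*} [MeasurableSpace Ω] {μ : Measure Ω} {p q : ℝ≥0∞}
    [ENNReal.HolderConjugate p q] (X : Lp ℝ p μ) (Z : Lp ℝ q μ) :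
    Integrable (fun ω => X ω * Z ω) μ :=
  (Lp.memLp X).integrable_mul (Lp.memLp Z)

/-- The bilinear pairing `(Z, X) ↦ E[X Z]` between `L^q` and `L^p`. -/
def pairing {Ω : Type*} [MeasurableSpace Ω] (μ : Measure Ω) (p q : ℝ≥0∞)
    [ENNReal.HolderConjugate p q] : Lp ℝ q μ →ₗ[ℝ] Lp ℝ p μ →ₗ[ℝ] ℝ :=
  LinearMap.mk₂ ℝ (fun Z X => ∫ ω, X ω * Z ω ∂μ)
    (by
      intro Z Z' X
      rw [← integral_add (integrable_mul X Z) (integrable_mul X Z')]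
      refine integral_congr_ae ?_
      filter_upwards [Lp.coeFn_add Z Z'] with ω h
      simp only [h, Pi.add_apply]; ring)
    (by
      intro c Z X
      rw [smul_eq_mul, ← integral_const_mul]
      refine integral_congr_ae ?_
      filter_upwards [Lp.coeFn_smul c Z] with ω h
      simp only [h, Pi.smul_apply, smul_eq_mul]; ring)
    (by
      intro Z X X'
      rw [← integral_add (integrable_mul X Z) (integrable_mul X' Z)]
      refine integral_congr_ae ?_
      filter_upwards [Lp.coeFn_add X X'] with ω h
      simp only [h, Pi.add_apply]; ring)
    (by
      intro c Z X
      rw [smul_eq_mul, ← integral_const_mul]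
      refine integral_congr_ae ?_
      filter_upwards [Lp.coeFn_smul c X] with ω h
      simp only [h, Pi.smul_apply, smul_eq_mul]; ring)

/-- Weak compactness of a subset of `L^q`, i.e. compactness for the topology `σ(L^q, L^p)`. For
`p = 1` this is the weak-* topology of `L^∞`. -/
def IsWeaklyCompact {Ω : Type*} [MeasurableSpace Ω] {μ : Measure Ω} (p : ℝ≥0∞) {q : ℝ≥0∞}
    [ENNReal.HolderConjugate p q] (A : Set (Lp ℝ q μ)) : Prop :=
  IsCompact (X := WeakBilin (pairing μ p q)) A

/-- The densities in `L^q`: `{Z ∈ L^q : Z ≥ 0, E[Z] = 1}`. -/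
def densities {Ω : Type*} [MeasurableSpace Ω] (μ : Measure Ω) (q : ℝ≥0∞) : Set (Lp ℝ q μ) :=
  {Z | 0 ≤ Z ∧ ∫ ω, Z ω ∂μ = 1}

/-- `A` is a convex, weakly compact set of densities in `L^q` that represents `D + E`:
`D X + E[X] = max_{Z ∈ A} E[X Z]` for all `X ∈ L^p`. -/
structure IsDualSet {Ω : Type*} [MeasurableSpace Ω] {μ : Measure Ω} {p q : ℝ≥0∞}
    [ENNReal.HolderConjugate p q] (D : Lp ℝ p μ → ℝ) (A : Set (Lp ℝ q μ)) : Prop where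
  subset : A ⊆ densities μ q
  convex : Convex ℝ A
  weaklyCompact : IsWeaklyCompact p A
  isGreatest : ∀ X : Lp ℝ p μ,
    IsGreatest ((fun Z : Lp ℝ q μ => ∫ ω, X ω * Z ω ∂μ) '' A) (D X + ∫ ω, X ω ∂μ)

/-- `sup {l ∈ [1, ∞) : l (Z - 1) + 1 ∈ A}`, with values in `[-∞, ∞]`; it lies in `[1, ∞]` for
`Z ∈ A`. -/
def scaleSup {Ω : Type*} [MeasurableSpace Ω] {μ : Measure Ω} [IsProbabilityMeasure μ]
    {q : ℝ≥0∞} (A : Set (Lp ℝ q μ)) (Z : Lp ℝ q μ) : EReal :=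
  ⨆ (l : ℝ) (_ : 1 ≤ l ∧ l • (Z - Lp.const q μ 1) + Lp.const q μ 1 ∈ A), (l : EReal)

/-- The function maximized over `Z ∈ A`:
`a E[X Z] - g*(a / sup {l ∈ [1, ∞) : l (Z - 1) + 1 ∈ A})`, with values in `[-∞, ∞)`. For
`Z ∈ A` the quotient is the real number `a / sup ∈ [0, a]`, being `0` when the supremum is `∞`. -/
def dualObjective {Ω : Type*} [MeasurableSpace Ω] {μ : Measure Ω} [IsProbabilityMeasure μ]
    {p q : ℝ≥0∞} (g : ℝ → ℝ) (a : ℝ) (A : Set (Lp ℝ q μ)) (X : Lp ℝ p μ)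
    (Z : Lp ℝ q μ) : EReal :=
  ((a * ∫ ω, X ω * Z ω ∂μ : ℝ) : EReal) - conjugate g ((a : EReal) / scaleSup A Z).toReal

end MeanDeviation

end

/-!
Write `R = D + E`. Range normalization gives `D X ≤ ess-sup X - E[X]`, so the sublinear functional
`R` is nonpositive on nonpositive random variables
(`IsRangeNormalized.add_integral_nonpos`).

*Existence of a dual set.* A linear functional below `R` is therefore positive. Positive functionals
on the Banach lattice `L^p` are continuous (`exists_bound_of_nonneg`), and as `p < ∞` they are
represented by elements of `L^q`: the density of the measure `s ↦ φ(1_s)` lies in `L^q` by the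
converse of Hölder's inequality (`exists_Lp_density_of_nonneg`). So the set `dominated q D` of all
`Z` with `E[X Z] ≤ R X` for every `X` is identified with the set of all linear functionals below
`R`. The latter is compact for pointwise convergence by Tychonoff's theorem, and by the Hahn-Banach
theorem it attains `R X` for each `X`; that its elements are densities follows by testing on
indicators and constants.

*The dual formula.* Let `A` be any dual set. By Hahn-Banach separation `1 ∈ A`
(`IsDualSet.const_one_mem`), so `A` is star-shaped around `1`. If `l (Z - 1) + 1 ∈ A`, then
`l (E[X Z] - E[X]) ≤ D X`. Hence `a (E[X Z] - E[X]) ≤ y D X` for `y = a / scaleSup A Z`, and the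
Fenchel-Young inequality bounds the objective by `g (D X) + a E[X]`. Conversely, choose a
subgradient `y ∈ [0, a]` of `g` at `D X > 0` and `Z₀ ∈ A` attaining `R X`. The density
`Z = 1 + (y / a) (Z₀ - 1)` lies in `A` and has `scaleSup A Z = a / y`, because `Z₀` cannot be moved
further away from `1` within `A`; it attains the bound. If `D X = 0` or `y = 0`, then `g (D X) = 0`
and `Z = 1` attains it.
-/

namespace MeanDeviation

/-! ### Positive functionals on Banach lattices -/

/-- Positive linear functionals on a Banach lattice are bounded: otherwise some summable series of
nonnegative vectors would have a sum on which the functional exceeds every `2 ^ n`. -/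
theorem exists_bound_of_nonneg {E : Type*} [NormedAddCommGroup E] [NormedSpace ℝ E]
    [CompleteSpace E] [Lattice E] [HasSolidNorm E] [IsOrderedAddMonoid E] [PosSMulMono ℝ E]
    (φ : E →ₗ[ℝ] ℝ) (hφ : ∀ x, 0 ≤ x → 0 ≤ φ x) :
    ∃ C : ℝ, ∀ x, |φ x| ≤ C * ‖x‖ := by
  have hmono : ∀ x y, x ≤ y → φ x ≤ φ y := fun x y h => by
    simpa using hφ (y - x) (sub_nonneg.2 h)
  have habs : ∀ x, |φ x| ≤ φ |x| := fun x => by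
    refine abs_le'.2 ⟨hmono _ _ (le_abs_self x), ?_⟩
    rw [← map_neg]; exact hmono _ _ (neg_le_abs x)
  by_contra! h
  choose x hx using fun n : ℕ => h (4 ^ n)
  have hpos : ∀ n, 0 < ‖x n‖ := fun n => by
    refine norm_pos_iff.2 fun h0 => ?_
    have := hx n
    simp [h0] at this
  set y : ℕ → E := fun n => (2 ^ n * ‖x n‖)⁻¹ • |x n| with hy
  have hy0 : ∀ n, 0 ≤ y n := fun n => smul_nonneg (by positivity) (abs_nonneg _)
  have hyn : ∀ n, ‖y n‖ = (1 / 2) ^ n := fun n => by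
    have := hpos n
    rw [hy]
    simp only [norm_smul, norm_inv, norm_mul, norm_pow, Real.norm_ofNat, norm_norm, norm_abs_eq_norm]
    rw [one_div, inv_pow]
    field_simp
  have hsum : Summable y := by
    refine Summable.of_norm ?_
    simp only [hyn]
    exact summable_geometric_two
  have hlt : ∀ n : ℕ, (2 : ℝ) ^ n < φ (∑' n, y n) := fun n => by
    refine lt_of_lt_of_le ?_ (hmono _ _ (hsum.le_tsum n fun j _ => hy0 j))
    have h1 := (hx n).trans_le (habs _)
    have h2 := hpos n
    rw [hy]
    simp only [map_smul, smul_eq_mul]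
    rw [lt_inv_mul_iff₀ (by positivity)]
    calc (2 : ℝ) ^ n * ‖x n‖ * 2 ^ n = 4 ^ n * ‖x n‖ := by
          rw [show (4 : ℝ) = 2 * 2 by norm_num, mul_pow]; ring
      _ < _ := h1
  obtain ⟨n, hn⟩ := pow_unbounded_of_one_lt (φ (∑' n, y n)) (one_lt_two)
  exact absurd (hlt n) (not_lt.2 hn.le)


/-- The compatibility of the order of `L^p` with scalars that `exists_bound_of_nonneg` needs. -/
theorem posSMulMono_Lp {Ω : Type*} [MeasurableSpace Ω] {μ : Measure Ω} {p : ℝ≥0∞} :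
    PosSMulMono ℝ (Lp ℝ p μ) := by
  refine ⟨fun c hc X Y hXY => ?_⟩
  rw [← Lp.coeFn_le] at hXY ⊢
  filter_upwards [hXY, Lp.coeFn_smul c X, Lp.coeFn_smul c Y] with ω h hX hY
  rw [hX, hY]
  exact mul_le_mul_of_nonneg_left h hc

/-! ### The converse of Hölder's inequality -/

/-- A Hölder type bound passes from finite simple functions to all measurable functions, by
monotone convergence. -/
theorem lintegral_mul_le_of_forall_simpleFunc {Ω : Type*} [MeasurableSpace Ω] {μ : Measure Ω}
    {p C : ℝ≥0∞} {f : Ω → ℝ≥0∞} (hf : Measurable f)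
    (h : ∀ g : SimpleFunc Ω NNReal, ∫⁻ ω, g ω * f ω ∂μ ≤ C * eLpNorm g p μ)
    {g : Ω → ℝ≥0∞} (hg : Measurable g) :
    ∫⁻ ω, g ω * f ω ∂μ ≤ C * eLpNorm g p μ := by
  have h1 : ∀ ω, g ω * f ω = ⨆ n, SimpleFunc.eapprox g n ω * f ω := fun ω => by
    rw [← ENNReal.iSup_mul, SimpleFunc.iSup_eapprox_apply hg]
  simp_rw [h1]
  rw [lintegral_iSup (f := fun n ω => SimpleFunc.eapprox g n ω * f ω)
    (fun n => (SimpleFunc.measurable _).mul hf) (fun m n hmn ω => mul_le_mul_left (SimpleFunc.monotone_eapprox g hmn ω) _)]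
  refine iSup_le fun n => ?_
  have h2 : ∀ ω, (((SimpleFunc.eapprox g n).map ENNReal.toNNReal ω : NNReal) : ℝ≥0∞)
      = SimpleFunc.eapprox g n ω := fun ω => by
    simp [ENNReal.coe_toNNReal (SimpleFunc.eapprox_lt_top g n ω).ne]
  refine le_trans (le_of_eq ?_) ((h ((SimpleFunc.eapprox g n).map ENNReal.toNNReal)).trans ?_)
  · simp_rw [h2]
  · gcongr
    refine eLpNorm_mono_enorm fun ω => ?_
    refine (le_of_eq (h2 ω)).trans ?_
    rw [enorm_eq_self, ← SimpleFunc.iSup_eapprox_apply hg ω]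
    exact le_iSup (fun n => SimpleFunc.eapprox g n ω) n

/-- Converse of Hölder's inequality: a function that pairs with `L^p` with norm at most `C` has
`L^q` norm at most `C`. -/
theorem eLpNorm_le_of_forall_lintegral_mul_le {Ω : Type*} [MeasurableSpace Ω] {μ : Measure Ω}
    [IsFiniteMeasure μ] {p q C : ℝ≥0∞} [hpq : ENNReal.HolderConjugate p q] (hp : p ≠ ∞)
    {f : Ω → ℝ≥0∞} (hf : Measurable f)
    (h : ∀ g : Ω → ℝ≥0∞, Measurable g → ∫⁻ ω, g ω * f ω ∂μ ≤ C * eLpNorm g p μ) :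
    eLpNorm f q μ ≤ C := by
  have hp1 : 1 ≤ p := ENNReal.HolderConjugate.one_le p q
  rcases eq_or_ne q ∞ with rfl | hq
  · have hp' : p = 1 := (ENNReal.HolderConjugate.unique ∞ p 1)
    subst hp'
    rw [eLpNorm_exponent_top]
    refine eLpNormEssSup_le_of_ae_enorm_bound ?_
    have := ae_le_of_forall_setLIntegral_le_of_sigmaFinite (μ := μ) hf (g := fun _ => C)
      (fun s hs _ => by
        have h1 := h (s.indicator 1) (measurable_one.indicator hs)
        rw [eLpNorm_one_eq_lintegral_enorm] at h1
        simp only [enorm_eq_self] at h1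
        rw [lintegral_indicator_one hs] at h1
        rw [setLIntegral_const, ← lintegral_indicator hs]
        refine le_trans (le_of_eq (lintegral_congr fun ω => ?_)) h1
        by_cases hω : ω ∈ s <;> simp [hω])
    filter_upwards [this] with ω hω using by simpa using hω
  · have hc := ENNReal.HolderConjugate.toReal_of_ne_top (p := p) (q := q) hp hq
    set r := p.toReal with hr
    set s := q.toReal with hs
    have hq0 : q ≠ 0 := (zero_lt_one.trans_le (ENNReal.HolderConjugate.one_le q p)).ne'
    have hp0 : p ≠ 0 := (zero_lt_one.trans_le hp1).ne'
    have hs1 : 1 < s := hc.symm.lt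
    -- Testing against `(min f n) ^ (s - 1)`; the truncation makes the integral `I` finite, so that
    -- `I ≤ C * I ^ (1 / r)` can be divided by `I ^ (1 / r)`.
    have key : ∀ n : ℕ, ∫⁻ ω, (min (f ω) n) ^ s ∂μ ≤ C ^ s := fun n => by
      set I := ∫⁻ ω, (min (f ω) n) ^ s ∂μ with hI
      have hItop : I ≠ ∞ := by
        refine ne_top_of_le_ne_top ?_ (lintegral_mono (g := fun _ => (n : ℝ≥0∞) ^ s) fun ω =>
          ENNReal.rpow_le_rpow (min_le_right _ _) (by linarith))
        rw [lintegral_const]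
        exact ENNReal.mul_ne_top (ENNReal.rpow_ne_top_of_nonneg (by linarith) (by simp))
          (measure_ne_top _ _)
      have h1 := h (fun ω => (min (f ω) n) ^ (s - 1)) (by fun_prop)
      rw [eLpNorm_eq_lintegral_rpow_enorm_toReal hp0 hp] at h1
      have h2 : ∫⁻ ω, ‖(min (f ω) n) ^ (s - 1)‖ₑ ^ p.toReal ∂μ = I := by
        refine lintegral_congr fun ω => ?_
        rw [enorm_eq_self, ← ENNReal.rpow_mul, ← hr, hc.symm.sub_one_mul_conj]
      rw [h2, ← hr] at h1
      have h3 : I ≤ C * I ^ (1 / r) := by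
        refine le_trans (lintegral_mono fun ω => ?_) h1
        calc (min (f ω) n) ^ s = (min (f ω) n) ^ (s - 1) * (min (f ω) n) := by
              conv_rhs => rw [← ENNReal.rpow_one (min (f ω) (n : ℝ≥0∞)), ← ENNReal.rpow_mul, one_mul]
              rw [← ENNReal.rpow_add_of_nonneg _ _ (by linarith) zero_le_one]
              simp
          _ ≤ _ := by gcongr; exact min_le_left _ _
      rcases eq_or_ne I 0 with h0 | h0
      · simp [h0]
      have h4 : I = I ^ (1 / s) * I ^ (1 / r) := by
        rw [← ENNReal.rpow_add _ _ h0 hItop, one_div, one_div, hc.symm.inv_add_inv_eq_one,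
          ENNReal.rpow_one]
      have h5 : I ^ (1 / s) ≤ C := by
        rw [h4] at h3
        refine (ENNReal.mul_le_mul_iff_left (c := I ^ (1 / r)) ?_ ?_).1 ?_
        · simp [h0, hItop]
        · exact ENNReal.rpow_ne_top_of_nonneg (by rw [one_div]; exact hc.inv_nonneg) hItop
        · convert h3 using 2; rw [← h4]
      calc I = (I ^ (1 / s)) ^ s := by
            rw [← ENNReal.rpow_mul, one_div_mul_cancel (by linarith), ENNReal.rpow_one]
        _ ≤ C ^ s := ENNReal.rpow_le_rpow h5 (by linarith)
    rw [eLpNorm_eq_lintegral_rpow_enorm_toReal hq0 hq, ← hs]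
    have h6 : ∫⁻ ω, ‖f ω‖ₑ ^ s ∂μ ≤ C ^ s := by
      have : ∀ ω, ‖f ω‖ₑ ^ s = ⨆ n : ℕ, (min (f ω) n) ^ s := fun ω => by
        have h7 : f ω = ⨆ n : ℕ, min (f ω) n := by
          rw [← inf_iSup_eq, ENNReal.iSup_natCast, inf_top_eq]
        conv_lhs => rw [enorm_eq_self, h7]
        exact (ENNReal.orderIsoRpow s (by linarith)).map_iSup _
      simp_rw [this]
      rw [lintegral_iSup (f := fun (n : ℕ) ω => (min (f ω) n) ^ s) (fun n => by fun_prop) (fun m n hmn ω => ENNReal.rpow_le_rpow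
        (min_le_min_left _ (by exact_mod_cast hmn)) (by linarith))]
      exact iSup_le key
    calc _ ≤ (C ^ s) ^ (1 / s) := ENNReal.rpow_le_rpow h6 (by positivity)
      _ = C := by rw [← ENNReal.rpow_mul, mul_one_div_cancel (by linarith), ENNReal.rpow_one]

/-! ### Riesz representation of positive functionals on `L^p` -/

theorem indicatorConstLp_nonneg {Ω : Type*} [MeasurableSpace Ω] {μ : Measure Ω} {p : ℝ≥0∞}
    {s : Set Ω} (hs : MeasurableSet s) (hμs : μ s ≠ ∞) {c : ℝ} (hc : 0 ≤ c) :
    0 ≤ indicatorConstLp p hs hμs c := by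
  rw [← Lp.coeFn_nonneg]
  filter_upwards [indicatorConstLp_coeFn (p := p) (hs := hs) (hμs := hμs) (c := c)] with ω h
  rw [h]
  exact indicator_nonneg (fun _ _ => hc) ω

/-- The set function `s ↦ φ(1_s)` of a positive continuous functional `φ` on `L^p`, `p < ∞`, is a
measure; countable additivity is the `L^p`-convergence of indicators. -/
theorem exists_measure_of_nonneg {Ω : Type*} [MeasurableSpace Ω] {μ : Measure Ω}
    [IsFiniteMeasure μ] {p : ℝ≥0∞} [Fact (1 ≤ p)] (hp : p ≠ ∞) (φ : Lp ℝ p μ →L[ℝ] ℝ)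
    (hφ : ∀ X, 0 ≤ X → 0 ≤ φ X) :
    ∃ ν : Measure Ω, ∀ (s : Set Ω) (hs : MeasurableSet s),
      ν s = ENNReal.ofReal (φ (indicatorConstLp p hs (measure_ne_top μ s) 1)) := by
  set m : ∀ s : Set Ω, MeasurableSet s → ℝ≥0∞ := fun s hs =>
    ENNReal.ofReal (φ (indicatorConstLp p hs (measure_ne_top μ s) 1)) with hm
  have hm0 : m ∅ MeasurableSet.empty = 0 := by simp [hm]
  have hadd : ∀ s t (hs : MeasurableSet s) (ht : MeasurableSet t), Disjoint s t →
      m (s ∪ t) (hs.union ht) = m s hs + m t ht := fun s t hs ht hst => by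
    simp only [hm]
    rw [indicatorConstLp_disjoint_union hs ht (measure_ne_top μ s) (measure_ne_top μ t) hst,
      map_add, ENNReal.ofReal_add]
    · exact hφ _ (indicatorConstLp_nonneg hs _ zero_le_one)
    · exact hφ _ (indicatorConstLp_nonneg ht _ zero_le_one)
  have hU : ∀ ⦃f : ℕ → Set Ω⦄ (h : ∀ i, MeasurableSet (f i)), Pairwise (Function.onFun Disjoint f) →
      m (⋃ i, f i) (MeasurableSet.iUnion h) = ∑' i, m (f i) (h i) := by
    intro f h hd
    set t : ℕ → Set Ω := fun n => ⋃ i < n, f i with ht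
    have htm : ∀ n, MeasurableSet (t n) := fun n =>
      MeasurableSet.iUnion fun i => MeasurableSet.iUnion fun _ => h i
    have hsucc : ∀ n, t (n + 1) = t n ∪ f n := fun n => biUnion_lt_succ f n
    have hfin : ∀ n, m (t n) (htm n) = ∑ i ∈ Finset.range n, m (f i) (h i) := fun n => by
      induction n with
      | zero => simpa [ht] using hm0
      | succ n ih =>
        have : m (t (n + 1)) (htm (n + 1)) = m (t n ∪ f n) ((htm n).union (h n)) := by
          congr 1; exact hsucc n
        rw [this, hadd _ _ (htm n) (h n) (disjoint_iUnion₂_left.2 fun i hi => hd (ne_of_lt hi)), ih,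
          Finset.sum_range_succ]
    have htmono : Monotone t := fun a b hab => biUnion_mono (fun i hi => lt_of_lt_of_le hi hab)
      (fun _ _ => subset_rfl)
    have htU : ⋃ n, t n = ⋃ i, f i := by
      ext ω
      simp only [ht, mem_iUnion]
      exact ⟨fun ⟨n, i, _, h⟩ => ⟨i, h⟩, fun ⟨i, h⟩ => ⟨i + 1, i, Nat.lt_succ_self i, h⟩⟩
    have hsd : Tendsto (fun n => μ (symmDiff (t n) (⋃ i, f i))) atTop (𝓝 0) := by
      have h1 : ∀ n, symmDiff (t n) (⋃ i, f i) = (⋃ i, f i) \ t n := fun n => by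
        rw [symmDiff_of_le]; rw [← htU]; exact subset_iUnion t n
      simp_rw [h1]
      have h2 := tendsto_measure_iInter_atTop (μ := μ) (s := fun n => (⋃ i, f i) \ t n)
        (fun n => ((MeasurableSet.iUnion h).diff (htm n)).nullMeasurableSet)
        (fun a b hab => sdiff_subset_sdiff_right (htmono hab)) ⟨0, measure_ne_top _ _⟩
      rwa [← sdiff_iUnion, htU, sdiff_self, measure_empty] at h2
    have hlim : Tendsto (fun n => m (t n) (htm n)) atTop
        (𝓝 (m (⋃ i, f i) (MeasurableSet.iUnion h))) :=
      ENNReal.tendsto_ofReal ((φ.continuous.tendsto _).comp (tendsto_indicatorConstLp_set hp hsd))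
    simp_rw [hfin] at hlim
    exact tendsto_nhds_unique hlim (ENNReal.tendsto_nat_tsum _)
  exact ⟨Measure.ofMeasurable m hm0 hU, fun s hs => Measure.ofMeasurable_apply s hs⟩

/-- Riesz representation of positive continuous functionals on `L^p`, `p < ∞`, over a finite
measure: `Z` is the Radon-Nikodym density of the measure `s ↦ φ(1_s)`. -/
theorem exists_Lp_density_of_nonneg {Ω : Type*} [MeasurableSpace Ω] {μ : Measure Ω}
    [IsFiniteMeasure μ] {p q : ℝ≥0∞} [Fact (1 ≤ p)] [ENNReal.HolderConjugate p q]
    (hp : p ≠ ∞) (φ : Lp ℝ p μ →L[ℝ] ℝ) (hφ : ∀ X, 0 ≤ X → 0 ≤ φ X) :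
    ∃ Z : Lp ℝ q μ, ∀ X, φ X = ∫ ω, X ω * Z ω ∂μ := by
  obtain ⟨ν, hν⟩ := exists_measure_of_nonneg hp φ hφ
  have : IsFiniteMeasure ν := ⟨by rw [hν _ MeasurableSet.univ]; exact ENNReal.ofReal_lt_top⟩
  have hac : ν ≪ μ := by
    refine Measure.AbsolutelyContinuous.mk fun s hs h0 => ?_
    rw [hν s hs]
    have : indicatorConstLp p hs (measure_ne_top μ s) (1 : ℝ) = 0 := by
      rw [← norm_eq_zero]
      have := norm_indicatorConstLp_le (p := p) (hs := hs) (hμs := measure_ne_top μ s) (c := (1 : ℝ))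
      have hp0 : (1 / p.toReal) ≠ 0 := by
        have := ENNReal.toReal_pos (zero_lt_one.trans_le (Fact.out : 1 ≤ p)).ne' hp
        positivity
      rw [measureReal_def, h0, ENNReal.toReal_zero, Real.zero_rpow hp0, mul_zero] at this
      exact le_antisymm this (norm_nonneg _)
    rw [this, map_zero, ENNReal.ofReal_zero]
  set f := ν.rnDeriv μ with hf
  have hfm : Measurable f := Measure.measurable_rnDeriv ν μ
  -- On nonnegative simple functions `φ` is integration against `ν`, which is all that is needed to
  -- bound the `L^q` norm of the density. Both functionals are then continuous, hence equal.
  have hsimple : ∀ g : SimpleFunc Ω NNReal, ∃ h : MemLp (fun ω => (g ω : ℝ)) p μ,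
      ∫⁻ ω, g ω ∂ν = ENNReal.ofReal (φ (h.toLp _)) := fun g => by
    have hmem : ∀ g : SimpleFunc Ω NNReal, MemLp (fun ω => (g ω : ℝ)) p μ := fun g =>
      (g.map ((↑) : NNReal → ℝ)).memLp_of_isFiniteMeasure p μ
    refine ⟨hmem g, ?_⟩
    induction g using SimpleFunc.induction with
    | @const c s hs =>
      have h1 : (hmem (SimpleFunc.piecewise s hs (SimpleFunc.const Ω c) (SimpleFunc.const Ω 0))).toLp
          _ = (c : ℝ) • indicatorConstLp p hs (measure_ne_top μ s) (1 : ℝ) := by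
        ext1
        refine (MemLp.coeFn_toLp _).trans ?_
        filter_upwards [Lp.coeFn_smul (c : ℝ) (indicatorConstLp p hs (measure_ne_top μ s) (1 : ℝ)),
          indicatorConstLp_coeFn (p := p) (hs := hs) (hμs := measure_ne_top μ s) (c := (1 : ℝ))]
          with ω h1 h2
        rw [h1, Pi.smul_apply, h2]
        by_cases hω : ω ∈ s <;> simp [hω]
      rw [h1, map_smul, smul_eq_mul, ENNReal.ofReal_mul c.coe_nonneg, ← hν s hs, ENNReal.ofReal_coe_nnreal]
      have h2 : ∀ ω, ((SimpleFunc.piecewise s hs (SimpleFunc.const Ω c) (SimpleFunc.const Ω 0) ω :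
          NNReal) : ℝ≥0∞) = s.indicator (fun _ => (c : ℝ≥0∞)) ω := fun ω => by
        by_cases hω : ω ∈ s <;> simp [hω]
      simp_rw [h2]
      rw [lintegral_indicator_const hs]
    | @add g₁ g₂ _ h₁ h₂ =>
      have h3 : (hmem (g₁ + g₂)).toLp _ = (hmem g₁).toLp _ + (hmem g₂).toLp _ := by
        rw [← MemLp.toLp_add]
        congr 1
      have hn : ∀ g : SimpleFunc Ω NNReal, 0 ≤ φ ((hmem g).toLp _) := fun g => by
        refine hφ _ ?_
        rw [← Lp.coeFn_nonneg]
        filter_upwards [(hmem g).coeFn_toLp] with ω h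
        rw [h]; exact (g ω).2
      rw [h3, map_add, ENNReal.ofReal_add (hn g₁) (hn g₂), ← h₁, ← h₂, ← lintegral_add_left
        (by fun_prop)]
      refine lintegral_congr fun ω => ?_
      simp
  have hbd : ∀ g : SimpleFunc Ω NNReal,
      ∫⁻ ω, g ω * f ω ∂μ ≤ ENNReal.ofReal ‖φ‖ * eLpNorm g p μ := fun g => by
    obtain ⟨h, hg⟩ := hsimple g
    have h1 : ∫⁻ ω, g ω * f ω ∂μ = ∫⁻ ω, g ω ∂ν := by
      rw [← lintegral_rnDeriv_mul hac (by fun_prop)]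
      simp_rw [mul_comm, hf]
    have h2 : eLpNorm g p μ = ENNReal.ofReal ‖h.toLp _‖ := by
      rw [Lp.norm_toLp, ENNReal.ofReal_toReal h.eLpNorm_ne_top]
      exact eLpNorm_congr_enorm_ae (ae_of_all _ fun ω => by
        rw [Real.enorm_of_nonneg (g ω).coe_nonneg, ENNReal.ofReal_coe_nnreal]; rfl)
    rw [h1, hg, h2, ← ENNReal.ofReal_mul (norm_nonneg _)]
    exact ENNReal.ofReal_le_ofReal ((Real.le_norm_self _).trans (φ.le_opNorm _))
  have hfq : eLpNorm f q μ ≤ ENNReal.ofReal ‖φ‖ := eLpNorm_le_of_forall_lintegral_mul_le hp hfm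
    fun g hg => lintegral_mul_le_of_forall_simpleFunc hfm hbd hg
  have hZ : MemLp (fun ω => (f ω).toReal) q μ := by
    refine ⟨hfm.ennreal_toReal.aestronglyMeasurable, lt_of_le_of_lt ?_
      (hfq.trans_lt ENNReal.ofReal_lt_top)⟩
    refine eLpNorm_mono_enorm fun ω => ?_
    rw [Real.enorm_of_nonneg ENNReal.toReal_nonneg, enorm_eq_self]
    exact ENNReal.ofReal_toReal_le
  refine ⟨hZ.toLp _, ?_⟩
  set Z : Lp ℝ q μ := hZ.toLp _ with hZdef
  have : Fact (1 ≤ q) := ⟨ENNReal.HolderConjugate.one_le q p⟩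
  set ψ : Lp ℝ p μ →L[ℝ] ℝ := ((ContinuousLinearMap.mul ℝ ℝ).lpPairing μ p q).flip Z with hψ
  have hψe : ∀ X, ψ X = ∫ ω, X ω * Z ω ∂μ := fun X => by
    rw [hψ, ContinuousLinearMap.flip_apply, ContinuousLinearMap.lpPairing_eq_integral]
    rfl
  simp_rw [← hψe]
  intro X
  induction X using Lp.induction hp with
  | indicatorConst c hs hμs =>
    rename_i s
    have h1 : ((Lp.simpleFunc.indicatorConst p hs hμs.ne c : Lp.simpleFunc ℝ p μ) : Lp ℝ p μ)
        = c • indicatorConstLp p hs hμs.ne (1 : ℝ) := by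
      rw [Lp.simpleFunc.coe_indicatorConst]
      ext1
      filter_upwards [Lp.coeFn_smul c (indicatorConstLp p hs hμs.ne (1 : ℝ)),
        indicatorConstLp_coeFn (p := p) (hs := hs) (hμs := hμs.ne) (c := (1 : ℝ)),
        indicatorConstLp_coeFn (p := p) (hs := hs) (hμs := hμs.ne) (c := c)] with ω h1 h2 h3
      rw [h1, Pi.smul_apply, h2, h3]
      by_cases hω : ω ∈ s <;> simp [hω]
    rw [h1, map_smul, map_smul]
    congr 1
    have h2 : ∫ ω, (indicatorConstLp p hs hμs.ne (1 : ℝ)) ω * Z ω ∂μ = ν.real s := by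
      rw [← Measure.setIntegral_toReal_rnDeriv hac, ← integral_indicator hs]
      refine integral_congr_ae ?_
      filter_upwards [hZ.coeFn_toLp,
        indicatorConstLp_coeFn (p := p) (hs := hs) (hμs := hμs.ne) (c := (1 : ℝ))] with ω h1 h2
      rw [h2, hZdef, h1]
      by_cases hω : ω ∈ s <;> simp [hω, hf]
    rw [hψe, h2, measureReal_def, hν s hs, ENNReal.toReal_ofReal]
    exact hφ _ (indicatorConstLp_nonneg hs _ zero_le_one)
  | add hf hg _ h₁ h₂ => rw [map_add, map_add, h₁, h₂]
  | isClosed => exact isClosed_eq φ.continuous ψ.continuous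

/-! ### The pairing between `L^q` and `L^p` -/

variable {Ω : Type*} [MeasurableSpace Ω] {μ : Measure Ω} {p q : ℝ≥0∞}

theorem pairing_apply [ENNReal.HolderConjugate p q] (Z : Lp ℝ q μ) (X : Lp ℝ p μ) :
    pairing μ p q Z X = ∫ ω, X ω * Z ω ∂μ := rfl

theorem integral_smul_Lp (c : ℝ) (X : Lp ℝ p μ) :
    ∫ ω, (c • X : Lp ℝ p μ) ω ∂μ = c * ∫ ω, X ω ∂μ := by
  rw [← integral_const_mul]
  exact integral_congr_ae (Lp.coeFn_smul c X)

variable [IsProbabilityMeasure μ]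

theorem integrable_coeFn (hp1 : 1 ≤ p) (X : Lp ℝ p μ) : Integrable (fun ω => X ω) μ :=
  (Lp.memLp X).integrable hp1

theorem integral_const_Lp (c : ℝ) : ∫ ω, Lp.const p μ c ω ∂μ = c := by
  rw [integral_congr_ae (Lp.coeFn_const (p := p) (μ := μ) c)]
  simp

theorem pairing_const_one [ENNReal.HolderConjugate p q] (X : Lp ℝ p μ) :
    pairing μ p q (Lp.const q μ 1) X = ∫ ω, X ω ∂μ := by
  rw [pairing_apply]
  refine integral_congr_ae ?_
  filter_upwards [Lp.coeFn_const (p := q) (μ := μ) (1 : ℝ)] with ω h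
  rw [h]; simp

theorem pairing_indicatorConstLp [ENNReal.HolderConjugate p q] (Z : Lp ℝ q μ) {s : Set Ω}
    (hs : MeasurableSet s) :
    pairing μ p q Z (indicatorConstLp p hs (measure_ne_top μ s) 1) = ∫ ω in s, Z ω ∂μ := by
  rw [pairing_apply, ← integral_indicator hs]
  refine integral_congr_ae ?_
  filter_upwards [indicatorConstLp_coeFn (p := p) (hs := hs) (hμs := measure_ne_top μ s)
    (c := (1 : ℝ))] with ω h
  rw [h]
  by_cases hω : ω ∈ s <;> simp [hω]

theorem pairing_injective [ENNReal.HolderConjugate p q] :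
    Function.Injective (pairing μ p q) := by
  intro Z Z' h
  have hq1 : 1 ≤ q := ENNReal.HolderConjugate.one_le q p
  refine Lp.ext ((integrable_coeFn hq1 Z).ae_eq_of_forall_setIntegral_eq _ _
    (integrable_coeFn hq1 Z') fun s hs _ => ?_)
  rw [← pairing_indicatorConstLp (p := p) Z hs, h, pairing_indicatorConstLp Z' hs]

theorem integral_add_Lp (hp1 : 1 ≤ p) (X Y : Lp ℝ p μ) :
    ∫ ω, (X + Y : Lp ℝ p μ) ω ∂μ = ∫ ω, X ω ∂μ + ∫ ω, Y ω ∂μ := by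
  rw [← integral_add (integrable_coeFn hp1 X) (integrable_coeFn hp1 Y)]
  exact integral_congr_ae (Lp.coeFn_add X Y)

/-! ### Range normalized deviation measures -/

theorem IsDeviationMeasure.zero {D : Lp ℝ p μ → ℝ} (hD : IsDeviationMeasure D) : D 0 = 0 := by
  simpa using hD.pos_homog 0 0 le_rfl

theorem IsDeviationMeasure.const {D : Lp ℝ p μ → ℝ} (hD : IsDeviationMeasure D) (c : ℝ) :
    D (Lp.const p μ c) = 0 := by
  simpa [hD.zero] using hD.add_const 0 c

/-- The mean-deviation functional `D + E` of a range normalized `D` is nonpositive on nonpositive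
random variables: `D X ≤ ess-sup X - E[X] ≤ -E[X]`. -/
theorem IsRangeNormalized.add_integral_nonpos {D : Lp ℝ p μ → ℝ} (hp1 : 1 ≤ p)
    (hD : IsRangeNormalized D) {X : Lp ℝ p μ} (hX : X ≤ 0) : D X + ∫ ω, X ω ∂μ ≤ 0 := by
  have hX0 : ∀ᵐ ω ∂μ, X ω ≤ 0 := by
    filter_upwards [(Lp.coeFn_le X 0).2 hX, Lp.coeFn_zero ℝ p μ] with ω h1 h2
    rwa [h2] at h1
  have hE0 : ∫ ω, X ω ∂μ ≤ 0 := integral_nonpos_of_ae hX0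
  by_cases hc : Nonconstant X
  swap
  · unfold Nonconstant at hc
    push Not at hc
    obtain ⟨c, rfl⟩ := hc
    rw [hD.const, zero_add]; exact hE0
  have hsup : (D X : EReal) / (essSupE X - ((∫ ω, X ω ∂μ : ℝ) : EReal)) ≤ 1 := by
    rw [← hD.sup_eq_one]
    exact le_iSup₂ (f := fun (X : Lp ℝ p μ) (_ : Nonconstant X) =>
      (D X : EReal) / (essSupE X - ((∫ ω, X ω ∂μ : ℝ) : EReal))) X hc
  have hs0 : essSupE X ≤ 0 := essSup_le_of_ae_le 0 (by
    filter_upwards [hX0] with ω h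
    exact_mod_cast h)
  have hle : ∀ᵐ ω ∂μ, ((X ω : ℝ) : EReal) ≤ essSupE X := ae_le_essSup
  obtain ⟨ω₀, hω₀⟩ := hle.exists
  have hbot : essSupE X ≠ ⊥ := fun h => by
    rw [h, le_bot_iff] at hω₀
    exact EReal.coe_ne_bot _ hω₀
  lift essSupE X to ℝ using ⟨ne_top_of_le_ne_top EReal.zero_ne_top hs0, hbot⟩ with s hs
  have hs0' : s ≤ 0 := by exact_mod_cast hs0
  have hle' : ∀ᵐ ω ∂μ, X ω ≤ s := by
    filter_upwards [hle] with ω h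
    exact_mod_cast h
  have hint := integrable_coeFn hp1 X
  have hsub : ∫ ω, (s - X ω) ∂μ = s - ∫ ω, X ω ∂μ := by
    rw [integral_sub (integrable_const s) hint]; simp
  -- The quotient by `ess-sup X - E[X]` is meaningful since this number is positive.
  have hpos : 0 < s - ∫ ω, X ω ∂μ := by
    have h0 : 0 ≤ᵐ[μ] fun ω => s - X ω := by
      filter_upwards [hle'] with ω h
      simpa using h
    refine lt_of_le_of_ne (hsub ▸ integral_nonneg_of_ae h0) fun h => hc s ?_
    rw [← hsub, eq_comm, integral_eq_zero_iff_of_nonneg_ae h0 ((integrable_const s).sub hint)] at h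
    refine Lp.ext ?_
    filter_upwards [h, Lp.coeFn_const (p := p) (μ := μ) s] with ω h1 h2
    rw [h2]
    simp only [Pi.zero_apply, Function.const_apply] at h1 ⊢
    linarith
  have h1 : D X / (s - ∫ ω, X ω ∂μ) ≤ 1 := by
    rw [← EReal.coe_sub, ← EReal.coe_div] at hsup
    exact_mod_cast hsup
  rw [div_le_one hpos] at h1
  linarith

/-! ### Existence of a dual set -/

/-- The largest candidate for a dual set of `D + E`: the elements of `L^q` whose pairing with
`L^p` is dominated by `D + E`. -/
def dominated (q : ℝ≥0∞) [ENNReal.HolderConjugate p q] (D : Lp ℝ p μ → ℝ) : Set (Lp ℝ q μ) :=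
  {Z | ∀ X, pairing μ p q Z X ≤ D X + ∫ ω, X ω ∂μ}

variable {D : Lp ℝ p μ → ℝ}

/-- Linear functionals below `D + E` are positive, hence continuous, hence represented by
elements of `L^q`. -/
theorem IsRangeNormalized.exists_mem_dominated [ENNReal.HolderConjugate p q] (hp1 : 1 ≤ p)
    (hp : p ≠ ∞) (hD : IsRangeNormalized D) (φ : Lp ℝ p μ →ₗ[ℝ] ℝ)
    (hφ : ∀ X, φ X ≤ D X + ∫ ω, X ω ∂μ) :
    ∃ Z ∈ dominated q D, pairing μ p q Z = φ := by
  have : Fact (1 ≤ p) := ⟨hp1⟩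
  have := posSMulMono_Lp (μ := μ) (p := p)
  have hnn : ∀ X, 0 ≤ X → 0 ≤ φ X := fun X hX => by
    have h := (hφ (-X)).trans (hD.add_integral_nonpos hp1 (neg_nonpos.2 hX))
    rw [map_neg] at h
    linarith
  obtain ⟨C, hC⟩ := exists_bound_of_nonneg φ hnn
  obtain ⟨Z, hZ⟩ := exists_Lp_density_of_nonneg (q := q) hp (φ.mkContinuous C hC) hnn
  have h : pairing μ p q Z = φ := LinearMap.ext fun X => (hZ X).symm
  exact ⟨Z, fun X => h ▸ hφ X, h⟩

/-- Nonnegativity comes from testing on `-1_s`, the total mass `1` from testing on `1` and `-1`. -/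
theorem IsRangeNormalized.dominated_subset [ENNReal.HolderConjugate p q] (hp1 : 1 ≤ p)
    (hD : IsRangeNormalized D) : dominated q D ⊆ densities μ q := by
  have hq1 : 1 ≤ q := ENNReal.HolderConjugate.one_le q p
  intro Z hZ
  refine ⟨?_, ?_⟩
  · rw [← Lp.coeFn_nonneg]
    refine ae_nonneg_of_forall_setIntegral_nonneg (integrable_coeFn hq1 Z) fun s hs _ => ?_
    have h1 := (hZ (-indicatorConstLp p hs (measure_ne_top μ s) 1)).trans
      (hD.add_integral_nonpos hp1 (neg_nonpos.2 (indicatorConstLp_nonneg hs _ zero_le_one)))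
    rw [map_neg, pairing_indicatorConstLp] at h1
    linarith
  · have key : ∀ c : ℝ, pairing μ p q Z (Lp.const p μ c) = c * ∫ ω, Z ω ∂μ := fun c => by
      rw [pairing_apply, ← integral_const_mul]
      refine integral_congr_ae ?_
      filter_upwards [Lp.coeFn_const (p := p) (μ := μ) c] with ω h
      rw [h]; simp
    have h1 := hZ (Lp.const p μ 1)
    have h2 := hZ (Lp.const p μ (-1))
    rw [key, hD.const, integral_const_Lp] at h1 h2
    linarith

/-- Weak compactness is Tychonoff's theorem: the dominated functionals form a closed subset of the
product of the intervals `[-(D + E)(-X), (D + E)(X)]`. -/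
theorem IsRangeNormalized.isWeaklyCompact_dominated [ENNReal.HolderConjugate p q] (hp1 : 1 ≤ p)
    (hp : p ≠ ∞) (hD : IsRangeNormalized D) : IsWeaklyCompact p (dominated q D) := by
  have hind : IsInducing (fun (Z : WeakBilin (pairing μ p q)) X => pairing μ p q Z X) := ⟨rfl⟩
  set N : Lp ℝ p μ → ℝ := fun X => D X + ∫ ω, X ω ∂μ with hN
  set K : Set (Lp ℝ p μ → ℝ) := {f | (∀ X Y, f (X + Y) = f X + f Y) ∧
    (∀ (c : ℝ) X, f (c • X) = c * f X) ∧ ∀ X, f X ≤ N X} with hK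
  have himg : (fun (Z : WeakBilin (pairing μ p q)) X => pairing μ p q Z X) '' (dominated q D) = K := by
    ext f
    constructor
    · rintro ⟨Z, hZ, rfl⟩
      exact ⟨fun X Y => map_add (pairing μ p q Z) X Y, fun c X => map_smul (pairing μ p q Z) c X, hZ⟩
    · rintro ⟨h1, h2, h3⟩
      obtain ⟨Z, hZ, hf⟩ := hD.exists_mem_dominated (q := q) hp1 hp ⟨⟨f, h1⟩, h2⟩ h3
      exact ⟨Z, hZ, funext fun X => LinearMap.congr_fun hf X⟩
  refine hind.isCompact_iff.2 (himg.symm ▸ ?_)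
  refine (isCompact_univ_pi fun X => isCompact_Icc (a := -N (-X)) (b := N X)).of_isClosed_subset
    ?_ ?_
  · simp only [hK, ofPred_and, ofPred_forall]
    refine IsClosed.inter ?_ (IsClosed.inter ?_ ?_)
    · exact isClosed_iInter fun X => isClosed_iInter fun Y => isClosed_eq (by fun_prop) (by fun_prop)
    · exact isClosed_iInter fun X => isClosed_iInter fun Y => isClosed_eq (by fun_prop) (by fun_prop)
    · exact isClosed_iInter fun X => isClosed_le (by fun_prop) (by fun_prop)
  · rintro f ⟨h1, h2, h3⟩ X -
    refine ⟨?_, h3 X⟩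
    have h4 := h2 (-1) X
    rw [neg_one_smul] at h4
    linarith [h3 (-X)]

/-- Hahn-Banach: the functional `c X ↦ c (D + E)(X)` on the line of `X` extends below `D + E`. -/
theorem IsRangeNormalized.exists_pairing_eq [ENNReal.HolderConjugate p q] (hp1 : 1 ≤ p)
    (hp : p ≠ ∞) (hD : IsRangeNormalized D) (X : Lp ℝ p μ) :
    ∃ Z ∈ dominated q D, pairing μ p q Z X = D X + ∫ ω, X ω ∂μ := by
  set N : Lp ℝ p μ → ℝ := fun X => D X + ∫ ω, X ω ∂μ with hN
  have hhom : ∀ c : ℝ, 0 ≤ c → ∀ Y, N (c • Y) = c * N Y := fun c hc Y => by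
    simp only [hN]
    rw [hD.pos_homog Y c hc, integral_smul_Lp]; ring
  have hadd : ∀ Y Y', N (Y + Y') ≤ N Y + N Y' := fun Y Y' => by
    have := hD.subadd Y Y'
    simp only [hN]
    rw [integral_add_Lp hp1]
    linarith
  have h0 : N 0 = 0 := by simpa using hhom 0 le_rfl 0
  have hwd : ∀ c : ℝ, c • X = 0 → c • N X = 0 := fun c hc => by
    rcases smul_eq_zero.1 hc with rfl | rfl
    · simp
    · simp [h0]
  set f : Lp ℝ p μ →ₗ.[ℝ] ℝ := LinearPMap.mkSpanSingleton' X (N X) hwd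
  have hf : ∀ (c : ℝ) (h : c • X ∈ f.domain), f ⟨c • X, h⟩ = c * N X :=
    LinearPMap.mkSpanSingleton'_apply X (N X) hwd
  obtain ⟨φ, hφ, hle⟩ := exists_extension_of_le_sublinear f N
    (fun c hc => hhom c hc.le) hadd (by
      rintro ⟨Y, hY⟩
      obtain ⟨c, rfl⟩ := Submodule.mem_span_singleton.1 hY
      rw [hf]
      rcases le_total 0 c with hc | hc
      · exact (hhom c hc X).ge
      · have h1 := hhom (-c) (neg_nonneg.2 hc) X
        have h2 := hadd (c • X) (-c • X)
        rw [← add_smul, add_neg_cancel, zero_smul, h0] at h2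
        change c * N X ≤ N (c • X)
        linarith)
  obtain ⟨Z, hZ, rfl⟩ := hD.exists_mem_dominated (q := q) hp1 hp φ hle
  refine ⟨Z, hZ, ?_⟩
  have hmem : (1 : ℝ) • X ∈ f.domain := by
    rw [one_smul]; exact Submodule.mem_span_singleton_self X
  have h2 := hf 1 hmem
  rw [← hφ] at h2
  simpa using h2

theorem IsRangeNormalized.isDualSet_dominated [ENNReal.HolderConjugate p q] (hp1 : 1 ≤ p)
    (hp : p ≠ ∞) (hD : IsRangeNormalized D) : IsDualSet D (dominated q D) where
  subset := hD.dominated_subset hp1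
  convex := by
    intro Z hZ Z' hZ' s t hs ht hst X
    rw [map_add, map_smul, map_smul, LinearMap.add_apply, LinearMap.smul_apply,
      LinearMap.smul_apply, smul_eq_mul, smul_eq_mul]
    have h1 := mul_le_mul_of_nonneg_left (hZ X) hs
    have h2 := mul_le_mul_of_nonneg_left (hZ' X) ht
    calc _ ≤ _ := add_le_add h1 h2
      _ = _ := by rw [← add_mul, hst, one_mul]
  weaklyCompact := hD.isWeaklyCompact_dominated hp1 hp
  isGreatest X := by
    refine ⟨?_, ?_⟩
    · obtain ⟨Z, hZ, h⟩ := hD.exists_pairing_eq (q := q) hp1 hp X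
      exact ⟨Z, hZ, h⟩
    · rintro _ ⟨Z, hZ, rfl⟩
      exact hZ X

/-! ### Geometry of dual sets -/

variable [ENNReal.HolderConjugate p q] {A : Set (Lp ℝ q μ)}

/-- Every dual set contains the constant density `1`: otherwise a weakly continuous functional,
i.e. some `X ∈ L^p`, would satisfy `max_{Z ∈ A} E[X Z] < E[X]`. -/
theorem IsDualSet.const_one_mem (hA : IsDualSet D A) (hD : ∀ X, 0 ≤ D X) :
    Lp.const q μ (1 : ℝ) ∈ A := by
  by_contra h
  have hinj : Function.Injective (fun (Z : WeakBilin (pairing μ p q)) X => pairing μ p q Z X) :=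
    fun Z Z' h => pairing_injective (LinearMap.ext fun X => congrFun h X)
  have : T2Space (WeakBilin (pairing μ p q)) :=
    (Topology.IsEmbedding.mk ⟨rfl⟩ hinj).t2Space
  have hconv : @Convex ℝ (WeakBilin (pairing μ p q)) _ _ _ _ A := hA.convex
  obtain ⟨f, u, hu, hlt⟩ := geometric_hahn_banach_closed_point (E := WeakBilin (pairing μ p q))
    hconv hA.weaklyCompact.isClosed h
  obtain ⟨X, rfl⟩ := LinearMap.dualEmbedding_surjective (pairing μ p q) f
  obtain ⟨Z, hZ, hZX⟩ := (hA.isGreatest X).1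
  have h1 : pairing μ p q Z X < u := hu Z hZ
  have h2 : u < pairing μ p q (Lp.const q μ 1) X := hlt
  rw [pairing_const_one] at h2
  rw [pairing_apply] at h1
  simp only at hZX
  linarith [hD X]

theorem integral_mul_smul_sub_one_add_one (X : Lp ℝ p μ) (Z : Lp ℝ q μ) (l : ℝ) :
    ∫ ω, X ω * (l • (Z - Lp.const q μ 1) + Lp.const q μ 1 : Lp ℝ q μ) ω ∂μ
      = l * (∫ ω, X ω * Z ω ∂μ - ∫ ω, X ω ∂μ) + ∫ ω, X ω ∂μ := by
  rw [← pairing_apply, map_add, map_smul, map_sub, LinearMap.add_apply, LinearMap.smul_apply,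
    LinearMap.sub_apply, pairing_const_one, pairing_apply, smul_eq_mul]

theorem IsDualSet.mul_integral_sub_le (hA : IsDualSet D A) (X : Lp ℝ p μ) {Z : Lp ℝ q μ} {l : ℝ}
    (hl : l • (Z - Lp.const q μ 1) + Lp.const q μ 1 ∈ A) :
    l * (∫ ω, X ω * Z ω ∂μ - ∫ ω, X ω ∂μ) ≤ D X := by
  have := (hA.isGreatest X).2 ⟨_, hl, rfl⟩
  simp only [integral_mul_smul_sub_one_add_one] at this
  linarith

theorem smul_sub_one_add_one_mem (hA : Convex ℝ A) (h1 : Lp.const q μ (1 : ℝ) ∈ A) {Z : Lp ℝ q μ}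
    (hZ : Z ∈ A) {t : ℝ} (ht0 : 0 ≤ t) (ht1 : t ≤ 1) :
    t • (Z - Lp.const q μ 1) + Lp.const q μ 1 ∈ A := by
  have := hA hZ h1 ht0 (sub_nonneg.2 ht1) (by ring)
  convert this using 1
  module

theorem one_le_scaleSup {Z : Lp ℝ q μ} (hZ : Z ∈ A) : 1 ≤ scaleSup A Z :=
  le_iSup₂_of_le (f := fun (l : ℝ) (_ : 1 ≤ l ∧ l • (Z - Lp.const q μ 1) + Lp.const q μ 1 ∈ A) =>
    (l : EReal)) 1 ⟨le_rfl, by simpa using hZ⟩ le_rfl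

theorem scaleSup_const_one (h1 : Lp.const q μ (1 : ℝ) ∈ A) :
    scaleSup A (Lp.const q μ (1 : ℝ)) = ⊤ := by
  rw [EReal.eq_top_iff_forall_lt]
  intro y
  have : ((max 1 (y + 1) : ℝ) : EReal) ≤ scaleSup A (Lp.const q μ (1 : ℝ)) :=
    le_iSup₂_of_le (f := fun (l : ℝ)
      (_ : 1 ≤ l ∧ l • (Lp.const q μ (1 : ℝ) - Lp.const q μ 1) + Lp.const q μ 1 ∈ A) =>
      (l : EReal)) (max 1 (y + 1)) ⟨le_max_left _ _, by simpa using h1⟩ le_rfl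
  refine lt_of_lt_of_le ?_ this
  exact_mod_cast lt_of_lt_of_le (lt_add_one y) (le_max_right _ _)

/-- If `l (Z - 1) + 1 ∈ A` then `l (E[X Z] - E[X]) ≤ D X`, which bounds `l` when `E[X Z] > E[X]`. -/
theorem IsDualSet.scaleSup_le (hA : IsDualSet D A) (X : Lp ℝ p μ) {Z : Lp ℝ q μ}
    (h : 0 < ∫ ω, X ω * Z ω ∂μ - ∫ ω, X ω ∂μ) :
    scaleSup A Z ≤ ((D X / (∫ ω, X ω * Z ω ∂μ - ∫ ω, X ω ∂μ) : ℝ) : EReal) :=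
  iSup₂_le fun _ hl => EReal.coe_le_coe_iff.2 ((le_div_iff₀ h).2 (hA.mul_integral_sub_le X hl.2))

/-- With `y = a / scaleSup A Z`, the excess `a (E[X Z] - E[X])` is at most `y D X`; when the supremum
is `∞` this says that `E[X Z] ≤ E[X]`. -/
theorem IsDualSet.mul_sub_le (hA : IsDualSet D A) (hD : ∀ X, 0 ≤ D X) {a : ℝ} (ha : 0 ≤ a)
    (X : Lp ℝ p μ) {Z : Lp ℝ q μ} (hZ : Z ∈ A) :
    a * (∫ ω, X ω * Z ω ∂μ - ∫ ω, X ω ∂μ) ≤ ((a : EReal) / scaleSup A Z).toReal * D X := by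
  have h1 := one_le_scaleSup hZ
  rcases le_or_gt (∫ ω, X ω * Z ω ∂μ - ∫ ω, X ω ∂μ) 0 with h | h
  · refine (mul_nonpos_of_nonneg_of_nonpos ha h).trans (mul_nonneg ?_ (hD X))
    exact EReal.toReal_nonneg (EReal.div_nonneg (by exact_mod_cast ha) (zero_le_one.trans h1))
  · have h2 := hA.scaleSup_le X h
    lift scaleSup A Z to ℝ using ⟨ne_top_of_le_ne_top (EReal.coe_ne_top _) h2,
      fun hb => EReal.coe_ne_bot 1 (le_bot_iff.1 (hb ▸ h1))⟩ with s
    have h1' : (1 : ℝ) ≤ s := by exact_mod_cast h1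
    have h2' := EReal.coe_le_coe_iff.1 h2
    rw [le_div_iff₀ h] at h2'
    rw [← EReal.coe_div, EReal.toReal_coe, div_mul_eq_mul_div, le_div_iff₀ (by linarith), mul_assoc]
    refine mul_le_mul_of_nonneg_left ?_ ha
    linarith

/-! ### Conjugates and subgradients -/

theorem le_conjugate (g : ℝ → ℝ) {x : ℝ} (hx : 0 ≤ x) (y : ℝ) :
    ((x * y - g x : ℝ) : EReal) ≤ conjugate g y :=
  le_iSup₂ (f := fun (x : ℝ) (_ : 0 ≤ x) => ((x * y - g x : ℝ) : EReal)) x hx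

theorem conjugate_eq_of_subgradient {g : ℝ → ℝ} {x y : ℝ} (hx : 0 ≤ x)
    (h : ∀ z, 0 ≤ z → g x + y * (z - x) ≤ g z) : conjugate g y = ((x * y - g x : ℝ) : EReal) :=
  le_antisymm (iSup₂_le fun z hz => EReal.coe_le_coe_iff.2 (by linarith [h z hz]))
    (le_conjugate g hx y)

/-- The left derivative of `g` at `x > 0` is a subgradient in `[0, a]`. -/
theorem exists_subgradient {g : ℝ → ℝ} (hmono : MonotoneOn g (Ici 0))
    (hconv : ConvexOn ℝ (Ici 0) g) {a : ℝ} (ha : Tendsto (leftDeriv g) atTop (𝓝 a)) {x : ℝ}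
    (hx : 0 < x) : ∃ y, 0 ≤ y ∧ y ≤ a ∧ ∀ z, 0 ≤ z → g x + y * (z - x) ≤ g z := by
  have hint : ∀ {z : ℝ}, 0 < z → z ∈ interior (Ici (0 : ℝ)) := fun hz => by
    rwa [interior_Ici, mem_Ioi]
  refine ⟨leftDeriv g x, ?_, ?_, fun z hz => ?_⟩
  · refine le_trans ?_ (hconv.slope_le_leftDeriv_of_mem_interior self_mem_Ici (hint hx) hx)
    rw [slope_def_field, sub_zero]
    exact div_nonneg (sub_nonneg.2 (hmono self_mem_Ici hx.le hx.le)) hx.le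
  · refine ge_of_tendsto ha ?_
    filter_upwards [eventually_ge_atTop x] with z hz
    exact hconv.monotoneOn_leftDeriv (hint hx) (hint (hx.trans_le hz)) hz
  · rcases lt_trichotomy z x with h | rfl | h
    · have := hconv.slope_le_leftDeriv_of_mem_interior hz (hint hx) h
      rw [slope_def_field, div_le_iff₀ (sub_pos.2 h)] at this
      unfold leftDeriv
      linarith
    · simp
    · have := (hconv.leftDeriv_le_rightDeriv_of_mem_interior (hint hx)).trans
        (hconv.rightDeriv_le_slope_of_mem_interior (hint hx) hz h)
      rw [slope_def_field, le_div_iff₀ (sub_pos.2 h)] at this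
      unfold leftDeriv
      linarith

theorem nonneg_of_tendsto_leftDeriv {g : ℝ → ℝ} (hmono : MonotoneOn g (Ici 0))
    (hconv : ConvexOn ℝ (Ici 0) g) {a : ℝ} (ha : Tendsto (leftDeriv g) atTop (𝓝 a)) : 0 ≤ a := by
  obtain ⟨y, h0, h1, -⟩ := exists_subgradient hmono hconv ha one_pos
  exact h0.trans h1

/-! ### The dual formula -/

/-- Weak duality: `IsDualSet.mul_sub_le` followed by the Fenchel-Young inequality
`y D X - g* y ≤ g (D X)`. -/
theorem IsDualSet.dualObjective_le (hA : IsDualSet D A) (hD : ∀ X, 0 ≤ D X) (g : ℝ → ℝ) {a : ℝ}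
    (ha : 0 ≤ a) (X : Lp ℝ p μ) {Z : Lp ℝ q μ} (hZ : Z ∈ A) :
    dualObjective g a A X Z ≤ ((g (D X) + a * ∫ ω, X ω ∂μ : ℝ) : EReal) := by
  refine (EReal.sub_le_sub le_rfl (le_conjugate g (hD X) _)).trans ?_
  rw [← EReal.coe_sub, EReal.coe_le_coe_iff]
  have := hA.mul_sub_le hD ha X hZ
  linarith

/-- The maximum is attained at `Z = 1 + (y / a) (Z₀ - 1)`, where `Z₀` attains `D X + E[X]` and `y` is
a subgradient of `g` at `D X`; it is attained at `Z = 1` if `D X = 0` or `y = 0`. -/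
theorem IsDualSet.exists_dualObjective_eq (hA : IsDualSet D A) (hD : ∀ X, 0 ≤ D X) {g : ℝ → ℝ}
    (hg : IsRiskWeighting g) (hconv : ConvexOn ℝ (Ici 0) g) {a : ℝ}
    (ha : Tendsto (leftDeriv g) atTop (𝓝 a)) (X : Lp ℝ p μ) :
    ∃ Z ∈ A, dualObjective g a A X Z = ((g (D X) + a * ∫ ω, X ω ∂μ : ℝ) : EReal) := by
  have h1A := hA.const_one_mem hD
  have hg0 : ∀ x, 0 ≤ x → 0 ≤ g x := fun x hx => hg.zero ▸ hg.mono self_mem_Ici hx hx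
  -- If `g (D X) = 0`, then `Z = 1` works: its `scaleSup` is `⊤`, and `conjugate g 0 = 0`.
  have hone : g (D X) = 0 →
      ∃ Z ∈ A, dualObjective g a A X Z = ((g (D X) + a * ∫ ω, X ω ∂μ : ℝ) : EReal) := fun h => by
    refine ⟨_, h1A, ?_⟩
    have hc : conjugate g 0 = ((0 * 0 - g 0 : ℝ) : EReal) :=
      conjugate_eq_of_subgradient le_rfl fun z hz => by simpa [hg.zero] using hg0 z hz
    rw [dualObjective, scaleSup_const_one h1A, EReal.div_top, EReal.toReal_zero, hc,
      ← pairing_apply, pairing_const_one, h, hg.zero, ← EReal.coe_sub]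
    simp
  rcases (hD X).eq_or_lt with hd | hd
  · exact hone (by rw [← hd, hg.zero])
  obtain ⟨y, hy0, hya, hy⟩ := exists_subgradient hg.mono hconv ha hd
  rcases hy0.eq_or_lt with rfl | hypos
  · exact hone (le_antisymm (by simpa [hg.zero] using hy 0 le_rfl) (hg0 _ (hD X)))
  have hapos : 0 < a := hypos.trans_le hya
  obtain ⟨Z₀, hZ₀, hX⟩ := (hA.isGreatest X).1
  simp only at hX
  set Z : Lp ℝ q μ := (y / a) • (Z₀ - Lp.const q μ 1) + Lp.const q μ 1 with hZ
  have hZA : Z ∈ A := smul_sub_one_add_one_mem hA.convex h1A hZ₀ (by positivity) ((div_le_one hapos).2 hya)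
  have hXZ : ∫ ω, X ω * Z ω ∂μ = (y / a) * D X + ∫ ω, X ω ∂μ := by
    rw [hZ, integral_mul_smul_sub_one_add_one, hX]; ring
  have hdiff : ∫ ω, X ω * Z ω ∂μ - ∫ ω, X ω ∂μ = (y / a) * D X := by rw [hXZ]; ring
  -- Since `D X > 0` and `Z₀` attains `D X + E[X]`, `Z₀` cannot be moved further away from `1`.
  have hscale : scaleSup A Z = ((a / y : ℝ) : EReal) := by
    refine le_antisymm ?_ ?_
    · refine (hA.scaleSup_le X (by rw [hdiff]; positivity)).trans (le_of_eq ?_)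
      rw [hdiff]
      congr 1
      field_simp
    · refine le_iSup₂_of_le (f := fun (l : ℝ)
        (_ : 1 ≤ l ∧ l • (Z - Lp.const q μ 1) + Lp.const q μ 1 ∈ A) => (l : EReal)) (a / y)
        ⟨(one_le_div hypos).2 hya, ?_⟩ le_rfl
      have : a / y * (y / a) = 1 := by field_simp
      rw [hZ, add_sub_cancel_right, smul_smul, this, one_smul, sub_add_cancel]
      exact hZ₀
  refine ⟨Z, hZA, ?_⟩
  have hdiv : ((a : EReal) / ((a / y : ℝ) : EReal)).toReal = y := by
    rw [← EReal.coe_div, EReal.toReal_coe]; field_simp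
  rw [dualObjective, hscale, hdiv, conjugate_eq_of_subgradient (hD X) hy, ← EReal.coe_sub, hXZ]
  congr 1
  field_simp
  ring

end MeanDeviation

theorem theorem4 {Ω : Type*} [MeasurableSpace Ω] (μ : Measure Ω) [IsProbabilityMeasure μ]
    (hμ : MeanDeviation.Nonatomic μ)
    (p q : ℝ≥0∞) (hp1 : 1 ≤ p) (hp : p ≠ ∞) [ENNReal.HolderConjugate p q]
    (g : ℝ → ℝ) (hg : MeanDeviation.IsRiskWeighting g) (hconv : ConvexOn ℝ (Ici 0) g)
    (a : ℝ) (ha : Tendsto (MeanDeviation.leftDeriv g) atTop (𝓝 a))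
    (D : Lp ℝ p μ → ℝ) (hD : MeanDeviation.IsRangeNormalized D) :
    (∃ A : Set (Lp ℝ q μ), MeanDeviation.IsDualSet D A) ∧
    ∀ A : Set (Lp ℝ q μ), MeanDeviation.IsDualSet D A →
      ∀ X : Lp ℝ p μ, ∃ m : ℝ,
        IsGreatest (MeanDeviation.dualObjective g a A X '' A) (m : EReal) ∧
        MeanDeviation.MD D g X = m + (1 - a) * ∫ ω, X ω ∂μ := by
  refine ⟨⟨_, hD.isDualSet_dominated hp1 hp⟩, fun A hA X => ?_⟩
  refine ⟨g (D X) + a * ∫ ω, X ω ∂μ, ⟨?_, ?_⟩, by rw [MeanDeviation.MD]; ring⟩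
  · obtain ⟨Z, hZ, h⟩ := hA.exists_dualObjective_eq hD.nonneg hg hconv ha X
    exact ⟨Z, hZ, h⟩
  · rintro _ ⟨Z, hZ, rfl⟩
    exact hA.dualObjective_le hD.nonneg g
      (MeanDeviation.nonneg_of_tendsto_leftDeriv hg.mono hconv ha) X hZ
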